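/- Let $c_{00}$ be the space of finitely supported real sequences $x=(x_j)_{j\ge 1}$ and, for a finite set $E\subset\{1,2,\dots\}$, let $E(x)$ be the sequence that agrees with $x$ on $E$ and vanishes off $E$. Call finite sets $(E_j)_{j=1}^n$ admissible if $n\le E_1<E_2<\dots<E_n$, that is, every element of every $E_j$ is at least $n$ and, for $i<j$, every element of $E_i$ is smaller than every element of $E_j$. Put $\|x\|_0=\max_j|x_j|$ and, for $k\ge 1$, $$\|x\|_k=\max\Big(\|x\|_{k-1},\ \tfrac12\max\Big\{\sum_{j=1}^n\|E_j(x)\|_{k-1} : (E_j)_{j=1}^n\text{ admissible}\Big\}\Big).$$ Let $T$ be the completion of $c_{00}$ for the norm $\|x\|=\lim_{k\to\infty}\|x\|_k=\sup_k\|x\|_k$, and let $T^*$ be the Banach space dual of $T$ (Tsirelson's original space). For a map $f\colon M\to N$ between metric spaces let $\rho_f(t)=\inf\{d_N(f(x),f(y)) : d_M(x,y)\ge t\}$ and $\omega_f(t)=\sup\{d_N(f(x),f(y)) : d_M(x,y)\le t\}$, with $\inf\emptyset=+\infty$ and $\sup\emptyset=0$. The map $f$ is a coarse embedding if $\lim_{t\to\infty}\rho_f(t)=\infty$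 and $\omega_f(t)<\infty$ for all $t>0$; it is a uniform embedding if $\lim_{t\to 0^+}\omega_f(t)=0$ and $\rho_f(t)>0$ for all $t>0$. Proposition. Let $X$ be a real Banach space with closed unit ball $B_X$. If there is a coarse embedding of $X$ into $T^*$, or a uniform embedding of $B_X$ into $T^*$, then $X$ is reflexive, i.e. the canonical embedding $X\to X^{**}$ is onto. -/

import Mathlib

open Filter Topology
open scoped ENNReal

noncomputable section

/-! ### Nonlinear embeddings -/

/-- The compression modulus `ρ_f(t) = inf {d(f x, f y) : d(x, y) ≥ t}`, with `inf ∅ = ∞`. -/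
def compressionModulus {X Y : Type*} [PseudoMetricSpace X] [PseudoMetricSpace Y]
    (f : X → Y) (t : ℝ) : ℝ≥0∞ :=
  ⨅ (x : X) (y : X) (_ : t ≤ dist x y), edist (f x) (f y)

/-- The expansion modulus `ω_f(t) = sup {d(f x, f y) : d(x, y) ≤ t}`, with `sup ∅ = 0`. -/
def expansionModulus {X Y : Type*} [PseudoMetricSpace X] [PseudoMetricSpace Y]
    (f : X → Y) (t : ℝ) : ℝ≥0∞ :=
  ⨆ (x : X) (y : X) (_ : dist x y ≤ t), edist (f x) (f y)

/-- `f` is a coarse embedding: `ρ_f(t) → ∞` as `t → ∞`, and `ω_f(t) < ∞` for all `t > 0`. -/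
def IsCoarseEmb {X Y : Type*} [PseudoMetricSpace X] [PseudoMetricSpace Y] (f : X → Y) : Prop :=
  Tendsto (compressionModulus f) atTop (𝓝 ∞) ∧ ∀ t : ℝ, 0 < t → expansionModulus f t < ∞

/-- `f` is a uniform embedding: `ω_f(t) → 0` as `t → 0`, and `ρ_f(t) > 0` for all `t > 0`. -/
def IsUniformEmb {X Y : Type*} [PseudoMetricSpace X] [PseudoMetricSpace Y] (f : X → Y) : Prop :=
  Tendsto (expansionModulus f) (𝓝[>] 0) (𝓝 0) ∧ ∀ t : ℝ, 0 < t → 0 < compressionModulus f t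

/-! ### The Tsirelson norm on finitely supported sequences

The positions of a sequence are the positive integers, so `c₀₀` is `ℕ+ →₀ ℝ`. -/

namespace Tsirelson

/-- `E₁, …, Eₙ` is admissible: `n ≤ E₁ < E₂ < ⋯ < Eₙ`. The order relations are required between
all members, so that empty sets (which are allowed) do not cut the chain. -/
def Admissible {n : ℕ} (E : Fin n → Finset ℕ+) : Prop :=
  (∀ i, ∀ a ∈ E i, n ≤ (a : ℕ)) ∧ ∀ i j, i < j → ∀ a ∈ E i, ∀ b ∈ E j, a < b

/-- The coordinate projection `E(x) = ∑_{j ∈ E} x_j e_j`. -/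
def restrict (E : Finset ℕ+) (x : ℕ+ →₀ ℝ) : ℕ+ →₀ ℝ := x.filter (· ∈ E)

/-- The norms `‖·‖_k`: `‖x‖₀ = max_j |x_j|` and `‖x‖_{k+1}` is the maximum of `‖x‖_k` and
`1/2 * max {∑_j ‖E_j(x)‖_k : (E_j) admissible}`. -/
def normStep : ℕ → (ℕ+ →₀ ℝ) → ℝ
  | 0, x => ⨆ j, |x j|
  | k + 1, x => max (normStep k x) (1 / 2 *
      sSup {s : ℝ | ∃ (n : ℕ) (E : Fin n → Finset ℕ+), Admissible E ∧
        s = ∑ j, normStep k (restrict (E j) x)})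

/-- The Tsirelson norm `‖x‖ = lim_k ‖x‖_k = sup_k ‖x‖_k`. -/
def tNorm (x : ℕ+ →₀ ℝ) : ℝ := ⨆ k, normStep k x

/-! The facts needed to see that this is a norm. -/

/-- The `ℓ₁` norm, an upper bound for all `‖·‖_k`. -/
def ellOne (x : ℕ+ →₀ ℝ) : ℝ := ∑ j ∈ x.support, |x j|

theorem restrict_add (E : Finset ℕ+) (x y : ℕ+ →₀ ℝ) :
    restrict E (x + y) = restrict E x + restrict E y := Finsupp.filter_add

theorem restrict_smul (E : Finset ℕ+) (c : ℝ) (x : ℕ+ →₀ ℝ) :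
    restrict E (c • x) = c • restrict E x := Finsupp.filter_smul

theorem ellOne_nonneg (x : ℕ+ →₀ ℝ) : 0 ≤ ellOne x := Finset.sum_nonneg fun _ _ => abs_nonneg _

theorem abs_le_ellOne (x : ℕ+ →₀ ℝ) (j : ℕ+) : |x j| ≤ ellOne x := by
  by_cases h : j ∈ x.support
  · exact Finset.single_le_sum (f := fun j => |x j|) (fun _ _ => abs_nonneg _) h
  · rw [Finsupp.notMem_support_iff.1 h, abs_zero]
    exact ellOne_nonneg x

theorem sum_ellOne_restrict_le {n : ℕ} {E : Fin n → Finset ℕ+} (hE : Admissible E)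
    (x : ℕ+ →₀ ℝ) : ∑ j, ellOne (restrict (E j) x) ≤ ellOne x := by
  have key : ∀ j, ellOne (restrict (E j) x) = ∑ a ∈ x.support with a ∈ E j, |x a| := by
    intro j
    unfold ellOne restrict
    rw [Finsupp.support_filter]
    refine Finset.sum_congr rfl fun a ha => ?_
    rw [Finsupp.filter_apply_pos _ _ (Finset.mem_filter.1 ha).2]
  simp only [key]
  rw [← Finset.sum_biUnion]
  · refine Finset.sum_le_sum_of_subset_of_nonneg ?_ fun _ _ _ => abs_nonneg _
    exact Finset.biUnion_subset.2 fun j _ => Finset.filter_subset _ _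
  · intro i _ j _ hij
    refine Finset.disjoint_left.2 fun a hi hj => ?_
    have hi' := (Finset.mem_filter.1 hi).2
    have hj' := (Finset.mem_filter.1 hj).2
    rcases lt_or_gt_of_ne hij with h | h
    · exact lt_irrefl _ (hE.2 _ _ h a hi' a hj')
    · exact lt_irrefl _ (hE.2 _ _ h a hj' a hi')

theorem normStep_nonneg (k : ℕ) (x : ℕ+ →₀ ℝ) : 0 ≤ normStep k x := by
  induction k with
  | zero => exact Real.iSup_nonneg fun _ => abs_nonneg _
  | succ k ih => exact le_max_of_le_left ih

theorem normStep_le_ellOne (k : ℕ) (x : ℕ+ →₀ ℝ) : normStep k x ≤ ellOne x := by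
  induction k generalizing x with
  | zero => exact ciSup_le fun j => abs_le_ellOne x j
  | succ k ih =>
    refine max_le (ih x) ?_
    have h : sSup {s : ℝ | ∃ (n : ℕ) (E : Fin n → Finset ℕ+), Admissible E ∧
        s = ∑ j, normStep k (restrict (E j) x)} ≤ ellOne x := by
      refine Real.sSup_le ?_ (ellOne_nonneg x)
      rintro s ⟨n, E, hE, rfl⟩
      exact (Finset.sum_le_sum fun j _ => ih _).trans (sum_ellOne_restrict_le hE x)
    linarith [ellOne_nonneg x]

theorem bddAbove_abs (x : ℕ+ →₀ ℝ) : BddAbove (Set.range fun j => |x j|) :=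
  ⟨ellOne x, by rintro _ ⟨j, rfl⟩; exact abs_le_ellOne x j⟩

theorem bddAbove_step (k : ℕ) (x : ℕ+ →₀ ℝ) :
    BddAbove {s : ℝ | ∃ (n : ℕ) (E : Fin n → Finset ℕ+), Admissible E ∧
        s = ∑ j, normStep k (restrict (E j) x)} := by
  refine ⟨ellOne x, ?_⟩
  rintro s ⟨n, E, hE, rfl⟩
  exact (Finset.sum_le_sum fun j _ => normStep_le_ellOne k _).trans (sum_ellOne_restrict_le hE x)

theorem bddAbove_normStep (x : ℕ+ →₀ ℝ) : BddAbove (Set.range fun k => normStep k x) :=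
  ⟨ellOne x, by rintro _ ⟨k, rfl⟩; exact normStep_le_ellOne k x⟩

theorem normStep_add_le (k : ℕ) (x y : ℕ+ →₀ ℝ) :
    normStep k (x + y) ≤ normStep k x + normStep k y := by
  induction k generalizing x y with
  | zero =>
    exact ciSup_le fun j => (abs_add_le _ _).trans
      (add_le_add (le_ciSup (bddAbove_abs x) j) (le_ciSup (bddAbove_abs y) j))
  | succ k ih =>
    refine max_le ((ih x y).trans (add_le_add (le_max_left _ _) (le_max_left _ _))) ?_
    refine le_trans ?_ (add_le_add (le_max_right _ _) (le_max_right _ _))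
    rw [← mul_add]
    refine mul_le_mul_of_nonneg_left ?_ (by norm_num)
    refine csSup_le ⟨0, 0, Fin.elim0, ⟨fun i => i.elim0, fun i => i.elim0⟩, by simp⟩ ?_
    rintro s ⟨n, E, hE, rfl⟩
    calc ∑ j, normStep k (restrict (E j) (x + y))
        ≤ ∑ j, (normStep k (restrict (E j) x) + normStep k (restrict (E j) y)) :=
          Finset.sum_le_sum fun j _ => by rw [restrict_add]; exact ih _ _
      _ = ∑ j, normStep k (restrict (E j) x) + ∑ j, normStep k (restrict (E j) y) :=
          Finset.sum_add_distrib
      _ ≤ _ := add_le_add (le_csSup (bddAbove_step k x) ⟨n, E, hE, rfl⟩)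
          (le_csSup (bddAbove_step k y) ⟨n, E, hE, rfl⟩)

theorem normStep_smul_le (k : ℕ) (c : ℝ) (x : ℕ+ →₀ ℝ) :
    normStep k (c • x) ≤ |c| * normStep k x := by
  induction k generalizing x with
  | zero =>
    refine ciSup_le fun j => ?_
    rw [Finsupp.smul_apply, smul_eq_mul, abs_mul]
    exact mul_le_mul_of_nonneg_left (le_ciSup (bddAbove_abs x) j) (abs_nonneg c)
  | succ k ih =>
    refine max_le ((ih x).trans
      (mul_le_mul_of_nonneg_left (le_max_left _ _) (abs_nonneg c))) ?_
    refine le_trans ?_ (mul_le_mul_of_nonneg_left (le_max_right _ _) (abs_nonneg c))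
    rw [mul_left_comm]
    refine mul_le_mul_of_nonneg_left ?_ (by norm_num)
    refine csSup_le ⟨0, 0, Fin.elim0, ⟨fun i => i.elim0, fun i => i.elim0⟩, by simp⟩ ?_
    rintro s ⟨n, E, hE, rfl⟩
    calc ∑ j, normStep k (restrict (E j) (c • x))
        ≤ ∑ j, |c| * normStep k (restrict (E j) x) :=
          Finset.sum_le_sum fun j _ => by rw [restrict_smul]; exact ih _
      _ = |c| * ∑ j, normStep k (restrict (E j) x) := (Finset.mul_sum _ _ _).symm
      _ ≤ _ := mul_le_mul_of_nonneg_left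
          (le_csSup (bddAbove_step k x) ⟨n, E, hE, rfl⟩) (abs_nonneg c)

theorem normStep_le_tNorm (k : ℕ) (x : ℕ+ →₀ ℝ) : normStep k x ≤ tNorm x :=
  le_ciSup (bddAbove_normStep x) k

theorem abs_le_tNorm (x : ℕ+ →₀ ℝ) (j : ℕ+) : |x j| ≤ tNorm x :=
  (le_ciSup (bddAbove_abs x) j).trans (normStep_le_tNorm 0 x)

theorem tNorm_nonneg (x : ℕ+ →₀ ℝ) : 0 ≤ tNorm x :=
  Real.iSup_nonneg fun k => normStep_nonneg k x

theorem tNorm_add_le (x y : ℕ+ →₀ ℝ) : tNorm (x + y) ≤ tNorm x + tNorm y :=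
  ciSup_le fun k => (normStep_add_le k x y).trans
    (add_le_add (normStep_le_tNorm k x) (normStep_le_tNorm k y))

theorem tNorm_smul_le (c : ℝ) (x : ℕ+ →₀ ℝ) : tNorm (c • x) ≤ |c| * tNorm x :=
  ciSup_le fun k => (normStep_smul_le k c x).trans
    (mul_le_mul_of_nonneg_left (normStep_le_tNorm k x) (abs_nonneg c))

theorem tNorm_smul (c : ℝ) (x : ℕ+ →₀ ℝ) : tNorm (c • x) = |c| * tNorm x := by
  refine le_antisymm (tNorm_smul_le c x) ?_
  rcases eq_or_ne c 0 with rfl | hc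
  · rw [abs_zero, zero_mul]
    exact tNorm_nonneg _
  · have h := tNorm_smul_le c⁻¹ (c • x)
    rw [inv_smul_smul₀ hc, abs_inv] at h
    have hc' : 0 < |c| := abs_pos.2 hc
    calc |c| * tNorm x ≤ |c| * (|c|⁻¹ * tNorm (c • x)) :=
          mul_le_mul_of_nonneg_left h hc'.le
      _ = tNorm (c • x) := by rw [mul_inv_cancel_left₀ hc'.ne']

theorem tNorm_eq_zero_iff (x : ℕ+ →₀ ℝ) : tNorm x = 0 ↔ x = 0 := by
  constructor
  · intro h
    ext j
    exact abs_nonpos_iff.1 (h ▸ abs_le_tNorm x j)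
  · rintro rfl
    simpa using tNorm_smul 0 (0 : ℕ+ →₀ ℝ)

end Tsirelson

/-! ### The spaces `T` and `T*` -/

/-- The vector space `c₀₀` of finitely supported real sequences, to carry the Tsirelson norm. -/
def TsirelsonC00 : Type := ℕ+ →₀ ℝ

instance : AddCommGroup TsirelsonC00 := inferInstanceAs (AddCommGroup (ℕ+ →₀ ℝ))

instance : Module ℝ TsirelsonC00 := inferInstanceAs (Module ℝ (ℕ+ →₀ ℝ))

instance : Norm TsirelsonC00 := ⟨Tsirelson.tNorm⟩

theorem tsirelsonCore : NormedSpace.Core ℝ TsirelsonC00 where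
  norm_nonneg := Tsirelson.tNorm_nonneg
  norm_smul := Tsirelson.tNorm_smul
  norm_triangle := Tsirelson.tNorm_add_le
  norm_eq_zero_iff := Tsirelson.tNorm_eq_zero_iff

instance : NormedAddCommGroup TsirelsonC00 := NormedAddCommGroup.ofCore tsirelsonCore

instance : NormedSpace ℝ TsirelsonC00 := NormedSpace.ofCore tsirelsonCore

/-- The space `T`: the completion of `c₀₀` for the Tsirelson norm. -/
abbrev TsirelsonT : Type := UniformSpace.Completion TsirelsonC00

/-- Tsirelson's original space `T*`: the Banach dual of `T`, with its dual norm. -/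
abbrev TsirelsonTStar : Type := StrongDual ℝ TsirelsonT

end

/-!
The proof plays two facts about maps on `ℕᵏ`, with the Hamming distance, against each other.

In the unit ball of a nonreflexive space `X` there is a sequence `x` (James, from Goldstine's
theorem applied to a bidual element off `X` and to a functional separating it from `X`) such that
`∑ x (q i)` and `∑ x (p i)` are at distance at least `θ k` when all entries of `q` exceed all
entries of `p`, while changing one coordinate moves the sum by at most `2`
(`exists_seq_of_not_reflexive`).

In `T*` such growth is impossible: an `L`-Lipschitz map `f` on `ℕᵏ` for the Hamming distance takes
values at distance at most `4 L + η` at some early and some late tuple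
(`Tsirelson.exists_lt_norm_sub_le`), with a bound independent of `k`. Indeed, let `y` be the
iterated weak* limit of `f` along a nonprincipal ultrafilter. For suitable tuples `p`, the
difference `f p - y` telescopes into `k` functionals of norm at most `L`, each weak*-close to `0`
relative to the previous ones. As the unit vector basis of `T` is shrinking
(`Tsirelson.exists_forall_abs_apply_le`), they are small perturbations of functionals on successive
finite sets `E₁ < ⋯ < E_k` beyond `k`, and admissibility of these sets gives
`∑ ‖E_j(x)‖ ≤ 2 ‖x‖`, so `‖f p - y‖ ≤ 2 L + η / 2`. Since `p` can be chosen beyond any given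
index, two such tuples can be compared.

Composing a coarse embedding with the sums `∑ x (p i)` bounds `ρ (θ k)` by `4 ω(2) + 1` for all
`k`; composing a uniform embedding of the ball with the averages bounds `ρ(θ)` by a multiple of
`ω(2 / k)`, up to an arbitrarily small error. Both are absurd.
-/

/-! ### James sequences in nonreflexive spaces -/

/-- Goldstine's theorem for finitely many functionals: an element `Φ` of the bidual with
`‖Φ‖ ≤ r` is approximated on them by a vector of norm at most `r`. -/
theorem exists_approx_of_mem_bidual {E : Type*} [NormedAddCommGroup E] [NormedSpace ℝ E]
    {ι : Type*} [Fintype ι] (g : ι → StrongDual ℝ E) (Φ : StrongDual ℝ (StrongDual ℝ E))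
    {r : ℝ} (hr : 0 < r) (hΦ : ‖Φ‖ ≤ r) {ε : ℝ} (hε : 0 < ε) :
    ∃ x : E, ‖x‖ ≤ r ∧ ∀ i, |g i x - Φ (g i)| < ε := by
  classical
  set G : E →L[ℝ] (ι → ℝ) := ContinuousLinearMap.pi g with hG
  set s : Set (ι → ℝ) := closure (G '' Metric.closedBall 0 r) with hs
  have hmem : (fun i => Φ (g i)) ∈ s := by
    by_contra hns
    have hconv : Convex ℝ s :=
      ((convex_closedBall (0 : E) r).linear_image G.toLinearMap).closure
    obtain ⟨f, u, hfs, hfu⟩ := geometric_hahn_banach_closed_point hconv isClosed_closure hns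
    -- `f` is a combination of coordinates, so that `f ∘ G` is a combination `h` of the `g i`
    set h : StrongDual ℝ E := ∑ i, f (Pi.single i 1) • g i with hh
    have hf : ∀ v : ι → ℝ, f v = ∑ i, f (Pi.single i 1) * v i := by
      intro v
      conv_lhs => rw [pi_eq_sum_univ' v]
      rw [map_sum]
      refine Finset.sum_congr rfl fun i _ => ?_
      rw [map_smul, smul_eq_mul, mul_comm]
    have hhx : ∀ x, h x = f (G x) := by
      intro x
      rw [hf, hh]
      simp [hG]
    have hhΦ : Φ h = f fun i => Φ (g i) := by
      rw [hf, hh]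
      simp
    have hlt : ∀ x : E, ‖x‖ ≤ r → h x < u := fun x hx => by
      rw [hhx]
      exact hfs _ (subset_closure ⟨x, by simpa using hx, rfl⟩)
    have hu : 0 < u := by simpa using hlt 0 (by simpa using hr.le)
    have hnorm : ‖h‖ ≤ u / r := by
      refine ContinuousLinearMap.opNorm_le_of_unit_norm (by positivity) fun x hx => ?_
      have h1 := hlt (r • x) (by rw [norm_smul, hx, mul_one, Real.norm_of_nonneg hr.le])
      have h2 := hlt (-(r • x))
        (by rw [norm_neg, norm_smul, hx, mul_one, Real.norm_of_nonneg hr.le])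
      rw [map_neg] at h2
      rw [map_smul, smul_eq_mul] at h1 h2
      rw [le_div_iff₀' hr, Real.norm_eq_abs, ← abs_of_pos hr, ← abs_mul, abs_le]
      constructor <;> linarith
    have := (le_abs_self _).trans (Φ.le_opNorm h)
    have h2 : ‖Φ‖ * ‖h‖ ≤ r * (u / r) := by gcongr
    rw [mul_div_cancel₀ _ hr.ne'] at h2
    linarith
  obtain ⟨_, ⟨x, hx, rfl⟩, hd⟩ := Metric.mem_closure_iff.1 hmem ε hε
  refine ⟨x, by simpa using hx, fun i => ?_⟩
  have := (dist_le_pi_dist _ _ i).trans_lt hd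
  rw [dist_comm, Real.dist_eq] at this
  exact this

-- the norm on the third dual is not found at the default depth
set_option maxSynthPendingDepth 3 in
/-- James' sequences: in the unit ball of a nonreflexive space there is a sequence along which
sums over late indices stay away from sums over equally many early ones. -/
theorem exists_seq_of_not_reflexive {X : Type*} [NormedAddCommGroup X] [NormedSpace ℝ X]
    [CompleteSpace X] (hX : ¬ Function.Surjective (NormedSpace.inclusionInDoubleDual ℝ X)) :
    ∃ (x : ℕ → X) (θ : ℝ), 0 < θ ∧ (∀ n, ‖x n‖ ≤ 1) ∧
      ∀ (k : ℕ) (p q : Fin k → ℕ), (∀ i j, p i < q j) →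
        θ * k ≤ ‖∑ i, x (q i) - ∑ i, x (p i)‖ := by
  classical
  set J := NormedSpace.inclusionInDoubleDual ℝ X with hJ
  obtain ⟨F₀, hF₀⟩ : ∃ F, ∀ x, J x ≠ F := by simpa [Function.Surjective] using hX
  have hiso : Isometry J := (NormedSpace.inclusionInDoubleDualLi ℝ (E := X)).isometry
  have hclosed : IsClosed (Set.range J) := hiso.isClosedEmbedding.isClosed_range
  have hconv : Convex ℝ (Set.range J) := by
    rw [← Set.image_univ]
    exact convex_univ.linear_image J.toLinearMap
  obtain ⟨φ, u, hφ, hu⟩ := geometric_hahn_banach_point_closed hconv hclosed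
    (x := F₀) (by rintro ⟨x, hx⟩; exact hF₀ x hx)
  -- a functional that is bounded below on a subspace vanishes there
  have hφJ : ∀ x, φ (J x) = 0 := by
    intro x
    by_contra hne
    have := hu _ ⟨((u - 1) / φ (J x)) • x, rfl⟩
    rw [map_smul, map_smul, smul_eq_mul, div_mul_cancel₀ _ hne] at this
    linarith
  have hφF : φ F₀ ≠ 0 := by
    have := hu _ ⟨0, rfl⟩
    rw [hφJ] at this
    linarith
  have hF₀ne : ‖F₀‖ ≠ 0 := by
    intro h
    rw [norm_eq_zero] at h
    exact hφF (by rw [h, map_zero])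
  set F := ‖F₀‖⁻¹ • F₀ with hF
  have hFn : ‖F‖ ≤ 1 := by
    rw [hF, norm_smul, norm_inv, norm_norm, inv_mul_cancel₀ hF₀ne]
  have hφF' : φ F ≠ 0 := by
    rw [hF, map_smul, smul_eq_mul]
    exact mul_ne_zero (inv_ne_zero hF₀ne) hφF
  set ψ := (φ F)⁻¹ • φ with hψ
  have hψF : ψ F = 1 := by simp [hψ, hφF']
  have hψJ : ∀ x, ψ (J x) = 0 := fun x => by simp [hψ, hφJ]
  set C : ℝ := ‖ψ‖ + 1 with hC
  have hC0 : 0 < C := by positivity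
  obtain ⟨s, hs, hss⟩ := exists_seq_of_forall_finset_exists
    (fun z : X × StrongDual ℝ X => ‖z.1‖ ≤ 1 ∧ ‖z.2‖ ≤ C ∧ 3 / 4 < F z.2 ∧ 1 / 2 < z.2 z.1)
    (fun z w => |w.2 z.1| < 1 / 4 ∧ 1 / 2 < z.2 w.1) (by
      intro S hS
      -- first a functional that is small on the old vectors, then a vector for all functionals
      obtain ⟨f, hfC, hf⟩ := exists_approx_of_mem_bidual
        (fun i : Option S => i.elim F fun z => J z.1.1) ψ hC0 (by linarith)
        (show (0 : ℝ) < 1 / 4 by norm_num)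
      have hfF : |F f - 1| < 1 / 4 := by simpa [hψF] using hf none
      have hfS : ∀ z ∈ S, |f z.1| < 1 / 4 := fun z hz => by
        have h := hf (some ⟨z, hz⟩)
        simp only [Option.elim_some, hψJ, sub_zero] at h
        exact h
      obtain ⟨x, hx1, hx⟩ := exists_approx_of_mem_bidual
        (fun i : Option S => i.elim f fun z => z.1.2) F one_pos hFn
        (show (0 : ℝ) < 1 / 4 by norm_num)
      have hxf : |f x - F f| < 1 / 4 := by simpa using hx none
      have hxS : ∀ z ∈ S, |z.2 x - F z.2| < 1 / 4 := fun z hz => by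
        simpa using hx (some ⟨z, hz⟩)
      rw [abs_lt] at hfF hxf
      refine ⟨(x, f), ⟨hx1, hfC, by linarith, by show 1 / 2 < f x; linarith⟩,
        fun z hz => ⟨hfS z hz, ?_⟩⟩
      have h1 := abs_lt.1 (hxS z hz)
      have h2 := (hS z hz).2.2.1
      show 1 / 2 < z.2 x
      linarith)
  refine ⟨fun n => (s n).1, 1 / (4 * C), by positivity, fun n => (hs n).1, fun k p q hpq => ?_⟩
  rcases Nat.eq_zero_or_pos k with rfl | hk
  · simp
  obtain ⟨i₀, hi₀⟩ : ∃ i₀, ∀ i, q i₀ ≤ q i := by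
    have : Nonempty (Fin k) := ⟨⟨0, hk⟩⟩
    exact Finite.exists_min q
  -- the functional attached to the first late index separates the two sums
  set f := (s (q i₀)).2 with hf
  have hq : ∑ _i : Fin k, (1 / 2 : ℝ) ≤ ∑ i, f (s (q i)).1 := by
    refine Finset.sum_le_sum fun i _ => ?_
    rcases (hi₀ i).eq_or_lt with h | h
    · rw [← h]; exact (hs _).2.2.2.le
    · exact (hss _ _ h).2.le
  have hp : ∑ i, f (s (p i)).1 ≤ ∑ _i : Fin k, (1 / 4 : ℝ) :=
    Finset.sum_le_sum fun i _ => ((le_abs_self _).trans_lt (hss _ _ (hpq i i₀)).1).le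
  have hle := (le_abs_self _).trans (f.le_opNorm (∑ i, (s (q i)).1 - ∑ i, (s (p i)).1))
  rw [map_sub, map_sum, map_sum] at hle
  simp only [Finset.sum_const, Finset.card_univ, Fintype.card_fin, nsmul_eq_mul] at hq hp
  have hfn : ‖f‖ ≤ C := (hs _).2.1
  have := mul_le_mul_of_nonneg_right hfn (norm_nonneg (∑ i, (s (q i)).1 - ∑ i, (s (p i)).1))
  rw [div_mul_eq_mul_div, div_le_iff₀ (by positivity)]
  linarith

/-! ### The implicit norm formula and restrictions in `T` -/

namespace Tsirelson

theorem restrict_apply (E : Finset ℕ+) (x : ℕ+ →₀ ℝ) (a : ℕ+) :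
    restrict E x a = if a ∈ E then x a else 0 := Finsupp.filter_apply _ _ _

theorem normStep_mono (x : ℕ+ →₀ ℝ) : Monotone fun k => normStep k x :=
  monotone_nat_of_le_succ fun _ => le_max_left _ _

theorem tendsto_normStep (x : ℕ+ →₀ ℝ) :
    Tendsto (fun k => normStep k x) atTop (𝓝 (tNorm x)) :=
  tendsto_atTop_ciSup (normStep_mono x) (bddAbove_normStep x)

theorem sum_normStep_restrict_le (k : ℕ) {n : ℕ} {E : Fin n → Finset ℕ+} (hE : Admissible E)
    (x : ℕ+ →₀ ℝ) : ∑ j, normStep k (restrict (E j) x) ≤ 2 * normStep (k + 1) x := by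
  have h1 := le_csSup (bddAbove_step k x) ⟨n, E, hE, rfl⟩
  have h2 : 1 / 2 * _ ≤ normStep (k + 1) x := le_max_right _ _
  linarith

theorem sum_tNorm_restrict_le {n : ℕ} {E : Fin n → Finset ℕ+} (hE : Admissible E)
    (x : ℕ+ →₀ ℝ) : ∑ j, tNorm (restrict (E j) x) ≤ 2 * tNorm x := by
  refine le_of_tendsto' (tendsto_finsetSum _ fun j _ => tendsto_normStep _) fun k => ?_
  have := sum_normStep_restrict_le k hE x
  have := normStep_le_tNorm (k + 1) x
  linarith

/-- One half of the implicit formula `‖x‖ = max (‖x‖₀, 1/2 max ∑ ‖E_j(x)‖)`. -/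
theorem tNorm_le_of_forall {x : ℕ+ →₀ ℝ} {C : ℝ} (h0 : ∀ a, |x a| ≤ C)
    (h : ∀ (n : ℕ) (E : Fin n → Finset ℕ+), Admissible E →
      ∑ j, tNorm (restrict (E j) x) ≤ 2 * C) : tNorm x ≤ C := by
  refine ciSup_le fun k => ?_
  induction k with
  | zero => exact ciSup_le h0
  | succ k ih =>
    refine max_le ih ?_
    have : sSup {s : ℝ | ∃ (n : ℕ) (E : Fin n → Finset ℕ+), Admissible E ∧
        s = ∑ j, normStep k (restrict (E j) x)} ≤ 2 * C := by
      refine Real.sSup_le ?_ (by linarith [(abs_nonneg _).trans (h0 1)])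
      rintro s ⟨n, E, hE, rfl⟩
      exact (Finset.sum_le_sum fun j _ => normStep_le_tNorm k _).trans (h n E hE)
    linarith

theorem normStep_filter_le (p : ℕ+ → Prop) [DecidablePred p] (k : ℕ) (x : ℕ+ →₀ ℝ) :
    normStep k (x.filter p) ≤ normStep k x := by
  induction k generalizing x with
  | zero =>
    refine ciSup_le fun a => le_trans ?_ (le_ciSup (bddAbove_abs x) a)
    rw [Finsupp.filter_apply]
    split_ifs
    · exact le_rfl
    · simp
  | succ k ih =>
    refine max_le ((ih x).trans (le_max_left _ _)) (le_trans ?_ (le_max_right _ _))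
    refine mul_le_mul_of_nonneg_left ?_ (by norm_num)
    refine csSup_le ⟨0, 0, Fin.elim0, ⟨fun i => i.elim0, fun i => i.elim0⟩, by simp⟩ ?_
    rintro s ⟨n, E, hE, rfl⟩
    refine le_trans (Finset.sum_le_sum fun j _ => ?_)
      (le_csSup (bddAbove_step k x) ⟨n, E, hE, rfl⟩)
    have : restrict (E j) (x.filter p) = (restrict (E j) x).filter p := by
      ext a
      simp only [restrict_apply, Finsupp.filter_apply]
      split_ifs <;> rfl
    rw [this]
    exact ih _

theorem tNorm_filter_le (p : ℕ+ → Prop) [DecidablePred p] (x : ℕ+ →₀ ℝ) :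
    tNorm (x.filter p) ≤ tNorm x :=
  ciSup_le fun k => (normStep_filter_le p k x).trans (normStep_le_tNorm k x)

theorem tNorm_restrict_le (E : Finset ℕ+) (x : ℕ+ →₀ ℝ) : tNorm (restrict E x) ≤ tNorm x :=
  tNorm_filter_le _ x

theorem restrict_sum {ι : Type*} (E : Finset ℕ+) (s : Finset ι) (v : ι → ℕ+ →₀ ℝ) :
    restrict E (∑ i ∈ s, v i) = ∑ i ∈ s, restrict E (v i) :=
  map_sum (Finsupp.filterAddHom (· ∈ E)) v s

theorem tNorm_zero : tNorm 0 = 0 := (tNorm_eq_zero_iff 0).2 rfl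

theorem tNorm_sum_le {ι : Type*} (s : Finset ι) (v : ι → ℕ+ →₀ ℝ) :
    tNorm (∑ i ∈ s, v i) ≤ ∑ i ∈ s, tNorm (v i) :=
  Finset.le_sum_of_subadditive tNorm tNorm_zero.le tNorm_add_le s v

/-! ### The basis of `T` is shrinking -/

/-- `v` is a block sequence: the supports are successive. -/
def IsBlock (v : ℕ → ℕ+ →₀ ℝ) : Prop :=
  ∀ i j, i < j → ∀ a ∈ (v i).support, ∀ b ∈ (v j).support, a < b

/-- Among successive blocks, at most `m` meet two members of a family `E₁ < ⋯ < E_m`, and each of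
the others contributes at most its norm. -/
theorem sum_sum_tNorm_restrict_le {v : ℕ → ℕ+ →₀ ℝ} (hv : IsBlock v) (h1 : ∀ i, tNorm (v i) ≤ 1)
    {m : ℕ} {E : Fin m → Finset ℕ+} (hE : Admissible E) (s : Finset ℕ) :
    ∑ i ∈ s, ∑ j, tNorm (restrict (E j) (v i)) ≤ s.card + m := by
  classical
  set D : ℕ → Prop := fun i => ∃ j j', j < j' ∧
    (∃ a ∈ E j, v i a ≠ 0) ∧ ∃ b ∈ E j', v i b ≠ 0 with hD
  have hcard : (s.filter D).card ≤ m := by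
    choose J J' hJ hJE hJE' using fun i (hi : D i) => hi
    have key : ∀ i i' (hi : D i) (hi' : D i'), J i hi = J i' hi' → ¬ i < i' := by
      intro i i' hi hi' h hlt
      obtain ⟨b, hb, hvb⟩ := hJE' i hi
      obtain ⟨a, ha, hva⟩ := hJE i' hi'
      rw [← h] at ha
      exact lt_asymm (hE.2 _ _ (hJ i hi) a ha b hb)
        (hv i i' hlt b (by simpa using hvb) a (by simpa using hva))
    have hinj : Function.Injective fun i : s.filter D => J i (Finset.mem_filter.1 i.2).2 :=
      fun i i' h => Subtype.ext (le_antisymm (not_lt.1 (key _ _ _ _ h.symm))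
        (not_lt.1 (key _ _ _ _ h)))
    simpa using Fintype.card_le_of_injective _ hinj
  have hterm : ∀ i, ∑ j, tNorm (restrict (E j) (v i)) ≤ 1 + if D i then 1 else 0 := by
    intro i
    split_ifs with hi
    · linarith [sum_tNorm_restrict_le hE (v i), h1 i]
    · rw [add_zero]
      by_cases hex : ∃ j, ∃ a ∈ E j, v i a ≠ 0
      · obtain ⟨j, hj⟩ := hex
        rw [Finset.sum_eq_single j]
        · exact (tNorm_restrict_le _ _).trans (h1 i)
        · intro j' _ hne
          rw [tNorm_eq_zero_iff]
          ext a
          rw [restrict_apply]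
          split_ifs with ha
          · by_contra hva
            rcases lt_or_gt_of_ne hne with h | h
            · exact hi ⟨j', j, h, ⟨a, ha, hva⟩, hj⟩
            · exact hi ⟨j, j', h, hj, ⟨a, ha, hva⟩⟩
          · rfl
        · simp
      · push Not at hex
        refine le_trans (le_of_eq (Finset.sum_eq_zero fun j _ => ?_)) zero_le_one
        rw [tNorm_eq_zero_iff]
        ext a
        rw [restrict_apply]
        split_ifs with ha
        · exact hex j a ha
        · rfl
  refine (Finset.sum_le_sum fun i _ => hterm i).trans ?_
  rw [Finset.sum_add_distrib, Finset.sum_boole, Finset.sum_const, nsmul_eq_mul, mul_one]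
  have : ((s.filter D).card : ℝ) ≤ m := by exact_mod_cast hcard
  linarith

/-- A block followed by a long average of blocks has norm well below `2`: an admissible family
that meets the first block has few members, so it can split only few blocks of the average. -/
theorem tNorm_add_average_le {v : ℕ → ℕ+ →₀ ℝ} (hv : IsBlock v) (h1 : ∀ i, tNorm (v i) ≤ 1)
    {r n : ℕ} (hr : ∀ a ∈ (v 0).support, (a : ℕ) ≤ r) (hn : 0 < n) :
    tNorm (v 0 + (n : ℝ)⁻¹ • ∑ i ∈ Finset.range n, v (i + 1)) ≤ 3 / 2 + r / n := by
  have hn' : (0 : ℝ) < n := by exact_mod_cast hn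
  have hrn : (0 : ℝ) ≤ r / n := by positivity
  set w := (n : ℝ)⁻¹ • ∑ i ∈ Finset.range n, v (i + 1) with hw
  have hw1 : tNorm w ≤ 1 := by
    rw [hw, tNorm_smul, abs_of_pos (inv_pos.2 hn'), inv_mul_le_one₀ hn']
    refine (tNorm_sum_le _ _).trans ((Finset.sum_le_sum fun i _ => h1 _).trans ?_)
    simp
  have hshift : IsBlock fun i => v (i + 1) := fun i j hij => hv _ _ (by omega)
  refine tNorm_le_of_forall (fun a => ?_) fun m E hE => ?_
  · rw [Finsupp.add_apply]
    by_cases ha : v 0 a = 0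
    · rw [ha, zero_add]
      linarith [abs_le_tNorm w a]
    · have : w a = 0 := by
        rw [hw, Finsupp.smul_apply, Finsupp.finsetSum_apply, Finset.sum_eq_zero, smul_zero]
        intro i _
        by_contra hne
        exact lt_irrefl _ (hv 0 (i + 1) (by omega) a (by simpa using ha) a (by simpa using hne))
      rw [this, add_zero]
      linarith [abs_le_tNorm (v 0) a, h1 0]
  · by_cases hmr : m ≤ r
    · have h2 := sum_tNorm_restrict_le hE (v 0)
      have h3 : ∑ j, tNorm (restrict (E j) w) ≤ 1 + r / n := by
        have hj : ∀ j, tNorm (restrict (E j) w) ≤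
            (n : ℝ)⁻¹ * ∑ i ∈ Finset.range n, tNorm (restrict (E j) (v (i + 1))) := by
          intro j
          rw [hw, restrict_smul, restrict_sum, tNorm_smul, abs_of_pos (inv_pos.2 hn')]
          exact mul_le_mul_of_nonneg_left (tNorm_sum_le _ _) (inv_pos.2 hn').le
        refine (Finset.sum_le_sum fun j _ => hj j).trans ?_
        rw [← Finset.mul_sum, Finset.sum_comm, inv_mul_le_iff₀ hn']
        refine (sum_sum_tNorm_restrict_le hshift (fun i => h1 _) hE _).trans ?_
        rw [Finset.card_range, mul_add, mul_one, mul_div_cancel₀ _ hn'.ne']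
        gcongr
      have h4 : ∑ j, tNorm (restrict (E j) (v 0 + w)) ≤
          ∑ j, tNorm (restrict (E j) (v 0)) + ∑ j, tNorm (restrict (E j) w) := by
        rw [← Finset.sum_add_distrib]
        exact Finset.sum_le_sum fun j _ => by rw [restrict_add]; exact tNorm_add_le _ _
      linarith [h1 0]
    · -- the family starts beyond the support of the first block
      have h0 : ∀ j, restrict (E j) (v 0 + w) = restrict (E j) w := by
        intro j
        have : restrict (E j) (v 0) = 0 := by
          ext a
          rw [restrict_apply]
          split_ifs with ha
          · by_contra hne
            have h5 := hE.1 j a ha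
            have h6 := hr a (by simpa using hne)
            omega
          · rfl
        rw [restrict_add, this, zero_add]
      simp only [h0]
      linarith [sum_tNorm_restrict_le hE w]

/-- The linear embedding of `c₀₀` in `T`. -/
noncomputable def toT : (ℕ+ →₀ ℝ) →ₗ[ℝ] TsirelsonT where
  toFun x := ((show TsirelsonC00 from x : TsirelsonC00) : TsirelsonT)
  map_add' x y := UniformSpace.Completion.coe_add (α := TsirelsonC00) x y
  map_smul' c x := UniformSpace.Completion.coe_smul (X := TsirelsonC00) c x

theorem norm_toT (x : ℕ+ →₀ ℝ) : ‖toT x‖ = tNorm x :=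
  UniformSpace.Completion.norm_coe (E := TsirelsonC00) x

theorem abs_apply_toT_le (y : TsirelsonTStar) (x : ℕ+ →₀ ℝ) : |y (toT x)| ≤ ‖y‖ * tNorm x := by
  rw [← norm_toT]
  exact y.le_opNorm _

theorem norm_le_of_forall_toT {y : TsirelsonTStar} {C : ℝ} (hC : 0 ≤ C)
    (h : ∀ x, |y (toT x)| ≤ C * tNorm x) : ‖y‖ ≤ C := by
  have h' : ∀ x, |y (toT x)| ≤ C * ‖toT x‖ := fun x => by
    rw [norm_toT]
    exact h x
  refine y.opNorm_le_bound hC fun z => ?_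
  induction z using UniformSpace.Completion.induction_on with
  | hp => exact isClosed_le (by fun_prop) (by fun_prop)
  | ih x => exact h' x

/-- The unit vector basis of `T` is shrinking: every functional is small on vectors supported far
out. Otherwise, with `δ` the limit of its norms on the tails, it is almost `2δ` on a block plus a
long average of blocks, and the norm of such a vector is well below `2`. -/
theorem exists_forall_abs_apply_le (y : TsirelsonTStar) {ε : ℝ} (hε : 0 < ε) :
    ∃ N : ℕ+, ∀ x : ℕ+ →₀ ℝ, (∀ a ∈ x.support, N < a) → |y (toT x)| ≤ ε * tNorm x := by
  set S : Set ℝ := {c | 0 ≤ c ∧ ∃ N : ℕ+, ∀ x : ℕ+ →₀ ℝ, (∀ a ∈ x.support, N < a) →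
    |y (toT x)| ≤ c * tNorm x} with hS
  have hne : S.Nonempty := ⟨‖y‖, norm_nonneg _, 1, fun x _ => abs_apply_toT_le y x⟩
  have hbdd : BddBelow S := ⟨0, fun c hc => hc.1⟩
  by_cases hlt : sInf S < ε
  · obtain ⟨c, ⟨-, N, hN⟩, hc⟩ := exists_lt_of_csInf_lt hne hlt
    exact ⟨N, fun x hx => (hN x hx).trans
      (mul_le_mul_of_nonneg_right hc.le (tNorm_nonneg x))⟩
  exfalso
  set δ := sInf S with hδ
  have hδ0 : 0 < δ := hε.trans_le (not_lt.1 hlt)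
  -- with these fractions and averages of `16 r` blocks, `2 * 15/16 > 17/16 * (3/2 + 1/16)`
  obtain ⟨c, ⟨hc0, N, hN⟩, hc⟩ : ∃ c ∈ S, c < δ * (17 / 16) :=
    exists_lt_of_csInf_lt hne (by rw [← hδ]; linarith)
  have hfar : ∀ M : ℕ+, ∃ x : ℕ+ →₀ ℝ, (∀ a ∈ x.support, M < a) ∧ tNorm x = 1 ∧
      δ * (15 / 16) < y (toT x) := by
    intro M
    have hd : δ * (15 / 16) ∉ S := fun h => by
      have := csInf_le hbdd h
      rw [← hδ] at this
      linarith
    obtain ⟨x, hx, hxy⟩ : ∃ x : ℕ+ →₀ ℝ, (∀ a ∈ x.support, M < a) ∧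
        δ * (15 / 16) * tNorm x < |y (toT x)| := by
      by_contra! hcon
      exact hd ⟨by positivity, M, hcon⟩
    have hpos : 0 < tNorm x := by
      refine (tNorm_nonneg x).lt_of_ne' fun h => ?_
      rw [h, (tNorm_eq_zero_iff x).1 h] at hxy
      simp at hxy
    obtain ⟨σ, hσ, hσy⟩ : ∃ σ : ℝ, |σ| = 1 ∧ σ * y (toT x) = |y (toT x)| := by
      rcases abs_choice (y (toT x)) with h | h
      · exact ⟨1, by simp, by rw [h, one_mul]⟩
      · exact ⟨-1, by simp, by rw [h, neg_one_mul]⟩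
    refine ⟨(σ * (tNorm x)⁻¹) • x, fun a ha => hx a (Finsupp.support_smul ha), ?_, ?_⟩
    · rw [tNorm_smul, abs_mul, hσ, one_mul, abs_of_pos (inv_pos.2 hpos),
        inv_mul_cancel₀ hpos.ne']
    · rw [map_smul, map_smul, smul_eq_mul, mul_right_comm, hσy, ← div_eq_mul_inv, lt_div_iff₀ hpos]
      exact hxy
  obtain ⟨v, hv, hblock⟩ := exists_seq_of_forall_finset_exists
    (fun x : ℕ+ →₀ ℝ => (∀ a ∈ x.support, N < a) ∧ tNorm x = 1 ∧ δ * (15 / 16) < y (toT x))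
    (fun x z => ∀ a ∈ x.support, ∀ b ∈ z.support, a < b) (by
      intro A _
      obtain ⟨x, hx, hx'⟩ := hfar (N ⊔ A.sup fun z => z.support.sup id)
      refine ⟨x, ⟨fun a ha => le_sup_left.trans_lt (hx a ha), hx'⟩, fun z hz a ha b hb => ?_⟩
      have h1 : a ≤ z.support.sup id := Finset.le_sup (f := id) ha
      have h2 := Finset.le_sup (f := fun z : ℕ+ →₀ ℝ => z.support.sup id) hz
      exact ((h1.trans h2).trans le_sup_right).trans_lt (hx b hb))
  set r : ℕ := (v 0).support.sup (fun a : ℕ+ => (a : ℕ)) + 1 with hr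
  have hn : 0 < 16 * r := by omega
  have hn' : (0 : ℝ) < (16 * r : ℕ) := by exact_mod_cast hn
  have hav := tNorm_add_average_le hblock (fun i => (hv i).2.1.le) (r := r)
    (fun a ha => (Finset.le_sup (f := fun a : ℕ+ => (a : ℕ)) ha).trans (Nat.le_succ _)) hn
  set w := v 0 + ((16 * r : ℕ) : ℝ)⁻¹ • ∑ i ∈ Finset.range (16 * r), v (i + 1) with hw
  have hwN : ∀ a ∈ w.support, N < a := by
    intro a ha
    by_contra hNa
    have h0 : ∀ i, v i a = 0 := fun i => by
      by_contra hne
      exact hNa ((hv i).1 a (by simpa using hne))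
    rw [Finsupp.mem_support_iff, hw] at ha
    simp [h0] at ha
  have hup := (le_abs_self _).trans (hN w hwN)
  have hsum : ((16 * r : ℕ) : ℝ) * (δ * (15 / 16)) ≤
      ∑ i ∈ Finset.range (16 * r), y (toT (v (i + 1))) := by
    have := Finset.sum_le_sum fun i (_ : i ∈ Finset.range (16 * r)) => (hv (i + 1)).2.2.le
    rwa [Finset.sum_const, Finset.card_range, nsmul_eq_mul] at this
  have hlow : δ * (15 / 16) + δ * (15 / 16) ≤ y (toT w) := by
    rw [hw, map_add, map_add, map_smul, map_smul, map_sum, map_sum, smul_eq_mul]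
    refine add_le_add (hv 0).2.2.le ?_
    rwa [le_inv_mul_iff₀ hn']
  have hr16 : (r : ℝ) / (16 * r : ℕ) = 1 / 16 := by
    have : (r : ℝ) ≠ 0 := by rw [hr]; positivity
    push_cast
    field_simp
  rw [hr16] at hav
  have h1 : c * tNorm w ≤ δ * (17 / 16) * (3 / 2 + 1 / 16) :=
    mul_le_mul hc.le hav (tNorm_nonneg w) (by positivity)
  linarith

end Tsirelson

/-! ### Iterated weak* limits and Hamming-Lipschitz maps -/

section IteratedLimit

variable {E : Type*} [NormedAddCommGroup E] [NormedSpace ℝ E]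

theorem exists_weakStar_ultralimit {u : ℕ → StrongDual ℝ E} {C : ℝ} (hu : ∀ n, ‖u n‖ ≤ C) :
    ∃ z : StrongDual ℝ E, ∀ x, Tendsto (fun n => u n x) (hyperfilter ℕ) (𝓝 (z x)) := by
  have hK := WeakDual.isCompact_closedBall (𝕜 := ℝ) (0 : StrongDual ℝ E) C
  obtain ⟨z, -, hz⟩ := hK.ultrafilter_le_nhds
    ((hyperfilter ℕ).map fun n => StrongDual.toWeakDual (u n)) (by
      rw [le_principal_iff]
      exact Filter.Eventually.of_forall (f := (hyperfilter ℕ : Filter ℕ)) fun n => by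
        simpa using hu n)
  refine ⟨WeakDual.toStrongDual z, fun x => ?_⟩
  exact ((WeakDual.eval_continuous x).tendsto z).comp hz

/-- The weak* limit of a bounded sequence of functionals along the fixed nonprincipal ultrafilter
`hyperfilter ℕ`; an arbitrary functional if there is no limit. -/
noncomputable def ultralimit (u : ℕ → StrongDual ℝ E) : StrongDual ℝ E :=
  Classical.epsilon fun z => ∀ x, Tendsto (fun n => u n x) (hyperfilter ℕ) (𝓝 (z x))

theorem tendsto_ultralimit {u : ℕ → StrongDual ℝ E} {C : ℝ} (hu : ∀ n, ‖u n‖ ≤ C) (x : E) :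
    Tendsto (fun n => u n x) (hyperfilter ℕ) (𝓝 (ultralimit u x)) :=
  Classical.epsilon_spec (exists_weakStar_ultralimit hu) x

/-- The dual norm is weak* lower semicontinuous. -/
theorem norm_le_of_tendsto_apply {v : ℕ → StrongDual ℝ E} {z : StrongDual ℝ E} {L : ℝ}
    (hv : ∀ n, ‖v n‖ ≤ L) (h : ∀ x, Tendsto (fun n => v n x) (hyperfilter ℕ) (𝓝 (z x))) :
    ‖z‖ ≤ L := by
  refine z.opNorm_le_bound ((norm_nonneg _).trans (hv 0)) fun x => ?_
  refine le_of_tendsto' (h x).norm fun n => ?_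
  exact (v n).le_of_opNorm_le (hv n) x

/-- The iterated weak* limit `lim_{n₁} ⋯ lim_{n_k} f(n₁, …, n_k)` along the ultrafilter. -/
noncomputable def iteratedLimit : (k : ℕ) → ((Fin k → ℕ) → StrongDual ℝ E) → StrongDual ℝ E
  | 0, f => f Fin.elim0
  | k + 1, f => ultralimit fun n => iteratedLimit k fun p => f (Fin.cons n p)

theorem norm_iteratedLimit_le {k : ℕ} {f : (Fin k → ℕ) → StrongDual ℝ E} {C : ℝ}
    (hf : ∀ p, ‖f p‖ ≤ C) : ‖iteratedLimit k f‖ ≤ C := by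
  induction k with
  | zero => exact hf _
  | succ k ih =>
    have h : ∀ n, ‖iteratedLimit k fun p => f (Fin.cons n p)‖ ≤ C := fun n => ih fun p => hf _
    exact norm_le_of_tendsto_apply h (tendsto_ultralimit h)

theorem norm_iteratedLimit_sub_le {k : ℕ} {f g : (Fin k → ℕ) → StrongDual ℝ E} {C L : ℝ}
    (hf : ∀ p, ‖f p‖ ≤ C) (hg : ∀ p, ‖g p‖ ≤ C) (h : ∀ p, ‖f p - g p‖ ≤ L) :
    ‖iteratedLimit k f - iteratedLimit k g‖ ≤ L := by
  induction k with
  | zero => exact h _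
  | succ k ih =>
    refine norm_le_of_tendsto_apply (fun n => ih (fun p => hf (Fin.cons n p))
      (fun p => hg (Fin.cons n p)) fun p => h (Fin.cons n p)) fun x => ?_
    exact (tendsto_ultralimit (fun n => norm_iteratedLimit_le fun p => hf (Fin.cons n p)) x).sub
      (tendsto_ultralimit (fun n => norm_iteratedLimit_le fun p => hg (Fin.cons n p)) x)

end IteratedLimit

/-- `f` is `L`-Lipschitz for the Hamming distance on `ℕᵏ`: changing one coordinate moves the value
by at most `L`. -/
def HammingLipschitz {Y : Type*} [NormedAddCommGroup Y] {k : ℕ} (L : ℝ) (f : (Fin k → ℕ) → Y) :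
    Prop :=
  ∀ (p : Fin k → ℕ) (i : Fin k) (m : ℕ), ‖f p - f (Function.update p i m)‖ ≤ L

namespace HammingLipschitz

variable {Y : Type*} [NormedAddCommGroup Y] {k : ℕ} {L : ℝ}

theorem cons {f : (Fin (k + 1) → ℕ) → Y} (hf : HammingLipschitz L f) (n : ℕ) :
    HammingLipschitz L fun p : Fin k → ℕ => f (Fin.cons n p) := by
  intro p i m
  beta_reduce
  rw [Fin.cons_update]
  exact hf _ _ _

theorem norm_cons_sub_cons_le {f : (Fin (k + 1) → ℕ) → Y} (hf : HammingLipschitz L f) (n m : ℕ)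
    (p : Fin k → ℕ) : ‖f (Fin.cons n p) - f (Fin.cons m p)‖ ≤ L := by
  have h := hf (Fin.cons n p) 0 m
  rwa [Fin.update_cons_zero] at h

theorem norm_sub_le {f : (Fin k → ℕ) → Y} (hf : HammingLipschitz L f) (p q : Fin k → ℕ) :
    ‖f p - f q‖ ≤ k * L := by
  induction k with
  | zero => simp [Subsingleton.elim p q]
  | succ k ih =>
    rw [← Fin.cons_self_tail p, ← Fin.cons_self_tail q]
    have h1 := ih (hf.cons (p 0)) (Fin.tail p) (Fin.tail q)
    have h2 := hf.norm_cons_sub_cons_le (p 0) (q 0) (Fin.tail q)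
    have h3 := norm_sub_le_norm_sub_add_norm_sub (f (Fin.cons (p 0) (Fin.tail p)))
      (f (Fin.cons (p 0) (Fin.tail q))) (f (Fin.cons (q 0) (Fin.tail q)))
    push_cast
    linarith

end HammingLipschitz

/-! ### Concentration in `T*` -/

namespace Tsirelson

theorem restrict_eq_sum (E : Finset ℕ+) (x : ℕ+ →₀ ℝ) :
    restrict E x = ∑ a ∈ E, x a • Finsupp.single a 1 := by
  ext b
  rw [restrict_apply, Finsupp.finsetSum_apply]
  simp [Finsupp.single_apply]

theorem abs_apply_restrict_le (y : TsirelsonTStar) (E : Finset ℕ+) (x : ℕ+ →₀ ℝ) :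
    |y (toT (restrict E x))| ≤ (∑ a ∈ E, |y (toT (Finsupp.single a 1))|) * tNorm x := by
  rw [restrict_eq_sum, map_sum, map_sum, Finset.sum_mul]
  refine (Finset.abs_sum_le_sum_abs _ _).trans (Finset.sum_le_sum fun a _ => ?_)
  rw [map_smul, map_smul, smul_eq_mul, abs_mul, mul_comm]
  exact mul_le_mul_of_nonneg_left (abs_le_tNorm x a) (abs_nonneg _)

theorem eq_restrict_add_restrict_add_filter (N M : ℕ+) (hNM : N ≤ M) (x : ℕ+ →₀ ℝ) :
    x = restrict (Finset.Icc 1 N) x + restrict (Finset.Ioc N M) x + x.filter (M < ·) := by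
  ext a
  simp only [Finsupp.add_apply, restrict_apply, Finsupp.filter_apply, Finset.mem_Icc,
    Finset.mem_Ioc, one_le, true_and]
  rcases le_or_gt a N with h | h
  · simp [h, h.not_gt, (h.trans hNM).not_gt]
  · rcases le_or_gt a M with h' | h'
    · simp [h, h.not_ge, h', h'.not_gt]
    · simp [h.not_ge, h'.not_ge, h']

/-- Along suitable tuples, a Hamming-Lipschitz map into `T*` differs from its iterated limit by a
sum of functionals of norm at most `L` that live, up to small errors, on successive finite sets.
The summand that belongs to a coordinate is weak*-close to `0`, hence small on a given initial
segment, and the basis is shrinking, hence it is small on a tail. -/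
theorem exists_tuple_near_iteratedLimit {k : ℕ} {f : (Fin k → ℕ) → TsirelsonTStar} {C L ε : ℝ}
    (hC : ∀ p, ‖f p‖ ≤ C) (hf : HammingLipschitz L f) (hε : 0 < ε) (N : ℕ+) (a : ℕ) :
    ∃ (p : Fin k → ℕ) (E : Fin k → Finset ℕ+), (∀ i, a < p i) ∧ (∀ i, ∀ b ∈ E i, N < b) ∧
      (∀ i j, i < j → ∀ b ∈ E i, ∀ c ∈ E j, b < c) ∧
      ∀ x, |(f p - iteratedLimit k f) (toT x)| ≤
        2 * k * ε * tNorm x + L * ∑ i, tNorm (restrict (E i) x) := by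
  induction k generalizing N with
  | zero =>
    refine ⟨Fin.elim0, Fin.elim0, fun i => i.elim0, fun i => i.elim0, fun i => i.elim0, fun x => ?_⟩
    simp [iteratedLimit]
  | succ k ih =>
    set g : ℕ → TsirelsonTStar := fun n => iteratedLimit k fun p => f (Fin.cons n p) with hg
    set z : TsirelsonTStar := iteratedLimit (k + 1) f with hz
    have hgC : ∀ n, ‖g n‖ ≤ C := fun n => norm_iteratedLimit_le fun p => hC _
    have hgz : ∀ w, Tendsto (fun n => g n w) (hyperfilter ℕ) (𝓝 (z w)) := tendsto_ultralimit hgC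
    have hgL : ∀ n m, ‖g n - g m‖ ≤ L := fun n m =>
      norm_iteratedLimit_sub_le (fun p => hC _) (fun p => hC _) (hf.norm_cons_sub_cons_le n m)
    have hgzL : ∀ n, ‖g n - z‖ ≤ L := fun n =>
      norm_le_of_tendsto_apply (hgL n) fun w => tendsto_const_nhds.sub (hgz w)
    have hsum : Tendsto
        (fun n => ∑ b ∈ Finset.Icc 1 N, |(g n - z) (toT (Finsupp.single b 1))|)
        (hyperfilter ℕ) (𝓝 0) := by
      rw [show (0 : ℝ) = ∑ _b ∈ Finset.Icc 1 N, 0 from Finset.sum_const_zero.symm]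
      refine tendsto_finsetSum _ fun b _ => ?_
      have := ((hgz (toT (Finsupp.single b 1))).sub_const (z (toT (Finsupp.single b 1)))).abs
      rwa [sub_self, abs_zero] at this
    obtain ⟨n, hn, han⟩ := ((hsum.eventually_lt_const hε).and
      (Nat.hyperfilter_le_atTop (eventually_gt_atTop a))).exists
    obtain ⟨M₀, hM₀⟩ := exists_forall_abs_apply_le (g n - z) hε
    set M := max N M₀ with hM
    obtain ⟨p, E, hp, hEM, hE, hx⟩ := ih (fun p => hC (Fin.cons n p)) (hf.cons n) M
    refine ⟨Fin.cons n p, Fin.cons (Finset.Ioc N M) E, ?_, ?_, ?_, fun x => ?_⟩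
    · exact Fin.cases han hp
    · refine Fin.cases (fun b hb => ?_) fun i b hb => ?_
      · exact (Finset.mem_Ioc.1 hb).1
      · exact (le_max_left _ _).trans_lt (hEM i b hb)
    · refine Fin.cases (fun j => ?_) fun i j => ?_
      · refine Fin.cases (fun h => absurd h (lt_irrefl _)) (fun j _ b hb c hc => ?_) j
        exact (Finset.mem_Ioc.1 hb).2.trans_lt (hEM j c hc)
      · refine Fin.cases (fun h => absurd h (Fin.not_lt_zero _)) (fun j h => ?_) j
        exact hE i j (Fin.succ_lt_succ_iff.1 h)
    · set y := g n - z with hy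
      have hsplit : |(f (Fin.cons n p) - z) (toT x)| ≤
          |(f (Fin.cons n p) - g n) (toT x)| + |y (toT x)| := by
        rw [← sub_add_sub_cancel (f (Fin.cons n p)) (g n) z]
        exact abs_add_le _ _
      have h1 : |y (toT (restrict (Finset.Icc 1 N) x))| ≤ ε * tNorm x :=
        (abs_apply_restrict_le _ _ _).trans (mul_le_mul_of_nonneg_right hn.le (tNorm_nonneg _))
      have h2 : |y (toT (restrict (Finset.Ioc N M) x))| ≤
          L * tNorm (restrict (Finset.Ioc N M) x) :=
        (abs_apply_toT_le _ _).trans (mul_le_mul_of_nonneg_right (hgzL n) (tNorm_nonneg _))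
      have h3 : |y (toT (x.filter (M < ·)))| ≤ ε * tNorm x := by
        refine (hM₀ _ fun b hb => ?_).trans (mul_le_mul_of_nonneg_left (tNorm_filter_le _ _) hε.le)
        rw [Finsupp.support_filter, Finset.mem_filter] at hb
        exact (le_max_right _ _).trans_lt hb.2
      have h4 : |y (toT x)| ≤ |y (toT (restrict (Finset.Icc 1 N) x))| +
          |y (toT (restrict (Finset.Ioc N M) x))| + |y (toT (x.filter (M < ·)))| := by
        conv_lhs => rw [eq_restrict_add_restrict_add_filter N M (le_max_left _ _) x]
        rw [map_add, map_add, map_add, map_add]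
        exact abs_add_three _ _ _
      have h5 : |(f (Fin.cons n p) - g n) (toT x)| ≤ _ := hx x
      rw [Fin.sum_univ_succ, Nat.cast_succ]
      simp only [Fin.cons_zero, Fin.cons_succ]
      linarith

/-- Concentration for Hamming-Lipschitz maps into `T*`: values at an early and at a late tuple
are at a distance bounded independently of the dimension `k`. -/
theorem exists_lt_norm_sub_le {k : ℕ} {f : (Fin k → ℕ) → TsirelsonTStar} {L η : ℝ}
    (hf : HammingLipschitz L f) (hL : 0 ≤ L) (hη : 0 < η) :
    ∃ p q : Fin k → ℕ, (∀ i j, p i < q j) ∧ ‖f p - f q‖ ≤ 4 * L + η := by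
  have hC : ∀ p, ‖f p‖ ≤ ‖f 0‖ + k * L := fun p => by
    have h1 := hf.norm_sub_le p 0
    have h2 := norm_le_norm_add_norm_sub' (f p) (f 0)
    linarith
  have key : ∀ a : ℕ, ∃ p : Fin k → ℕ, (∀ i, a < p i) ∧
      ‖f p - iteratedLimit k f‖ ≤ 2 * L + η / 2 := by
    intro a
    obtain ⟨p, E, hp, hEk, hE, hx⟩ := exists_tuple_near_iteratedLimit hC hf
      (show 0 < η / (4 * (k + 1)) by positivity) k.succPNat a
    refine ⟨p, hp, norm_le_of_forall_toT (by positivity) fun x => (hx x).trans ?_⟩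
    -- the sets `E i` lie beyond `k`, so that they are admissible
    have hadm : Admissible E := ⟨fun i b hb => by
      have h : k.succPNat < b := hEk i b hb
      have h' : (k.succPNat : ℕ) < b := h
      rw [Nat.succPNat_coe] at h'
      omega, hE⟩
    have h1 := mul_le_mul_of_nonneg_left (sum_tNorm_restrict_le hadm x) hL
    have h2 : 2 * k * (η / (4 * (k + 1))) ≤ η / 2 := by
      rw [← mul_div_assoc, div_le_div_iff₀ (by positivity) two_pos]
      nlinarith
    have h3 := mul_le_mul_of_nonneg_right h2 (tNorm_nonneg x)
    linarith
  obtain ⟨p, -, hp⟩ := key 0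
  obtain ⟨q, hq, hq'⟩ := key (Finset.univ.sup p)
  refine ⟨p, q, fun i j => (Finset.le_sup (Finset.mem_univ i)).trans_lt (hq j), ?_⟩
  have h := norm_sub_le_norm_sub_add_norm_sub (f p) (iteratedLimit k f) (f q)
  rw [norm_sub_rev (iteratedLimit k f)] at h
  linarith

end Tsirelson

/-! ### Moduli of nonlinear embeddings -/

open Tsirelson

theorem compressionModulus_le_edist {X Y : Type*} [PseudoMetricSpace X] [PseudoMetricSpace Y]
    (f : X → Y) {t : ℝ} {x y : X} (h : t ≤ dist x y) :
    compressionModulus f t ≤ edist (f x) (f y) :=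
  iInf_le_of_le x (iInf_le_of_le y (iInf_le _ h))

theorem edist_le_expansionModulus {X Y : Type*} [PseudoMetricSpace X] [PseudoMetricSpace Y]
    (f : X → Y) {t : ℝ} {x y : X} (h : dist x y ≤ t) :
    edist (f x) (f y) ≤ expansionModulus f t :=
  le_iSup_of_le x (le_iSup_of_le y (le_iSup (fun _ => edist (f x) (f y)) h))

/-- If a metric space contains a copy of `ℕᵏ` with Hamming steps of length at most `t` and with
early and late tuples at distance at least `s`, then concentration in `T*` bounds `ρ_g(s)` by
`ω_g(t)`, independently of `k`. -/
theorem exists_lt_compressionModulus_le {Z : Type*} [PseudoMetricSpace Z] (g : Z → TsirelsonTStar)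
    {k : ℕ} (σ : (Fin k → ℕ) → Z) {s t L η : ℝ}
    (hstep : ∀ p i m, dist (σ p) (σ (Function.update p i m)) ≤ t)
    (hfar : ∀ p q : Fin k → ℕ, (∀ i j, p i < q j) → s ≤ dist (σ p) (σ q))
    (hL : 0 ≤ L) (hω : expansionModulus g t ≤ ENNReal.ofReal L) (hη : 0 < η) :
    compressionModulus g s ≤ ENNReal.ofReal (4 * L + η) := by
  have hlip : HammingLipschitz L fun p => g (σ p) := by
    intro p i m
    have := (edist_le_expansionModulus g (hstep p i m)).trans hω
    rwa [edist_dist, ENNReal.ofReal_le_ofReal_iff hL, dist_eq_norm] at this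
  obtain ⟨p, q, hpq, h⟩ := exists_lt_norm_sub_le hlip hL hη
  refine (compressionModulus_le_edist g (hfar p q hpq)).trans ?_
  rw [edist_dist, dist_eq_norm]
  exact ENNReal.ofReal_le_ofReal h

theorem norm_sum_sub_sum_update_le {X : Type*} [NormedAddCommGroup X] {x : ℕ → X}
    (hx : ∀ n, ‖x n‖ ≤ 1) {k : ℕ} (p : Fin k → ℕ) (i : Fin k) (m : ℕ) :
    ‖∑ j, x (p j) - ∑ j, x (Function.update p i m j)‖ ≤ 2 := by
  rw [← Finset.sum_sub_distrib, Finset.sum_eq_single i]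
  · have h1 := hx (p i)
    have h2 := hx (Function.update p i m i)
    have h3 := norm_sub_le (x (p i)) (x (Function.update p i m i))
    linarith
  · intro j _ hj
    rw [Function.update_of_ne hj, sub_self]
  · simp

theorem propositionP {X : Type*} [NormedAddCommGroup X] [NormedSpace ℝ X] [CompleteSpace X]
    (hX : (∃ f : X → TsirelsonTStar, IsCoarseEmb f) ∨
      (∃ f : Metric.closedBall (0 : X) 1 → TsirelsonTStar, IsUniformEmb f)) :
    Function.Surjective (NormedSpace.inclusionInDoubleDual ℝ X) := by
  by_contra hrefl
  obtain ⟨x, θ, hθ, hx, hsep⟩ := exists_seq_of_not_reflexive hrefl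
  rcases hX with ⟨g, hρ, hω⟩ | ⟨g, hω, hρ⟩
  · -- the sums `∑ x (p i)` have Hamming steps at most `2` and separation `θ k`
    set L := (expansionModulus g 2).toReal with hL
    have hωL : expansionModulus g 2 ≤ ENNReal.ofReal L :=
      (ENNReal.ofReal_toReal (hω 2 two_pos).ne).ge
    have hle : ∀ k : ℕ, compressionModulus g (θ * k) ≤ ENNReal.ofReal (4 * L + 1) := fun k =>
      exists_lt_compressionModulus_le g (fun p : Fin k → ℕ => ∑ i, x (p i))
        (fun p i m => by
          rw [dist_eq_norm]
          exact norm_sum_sub_sum_update_le hx p i m)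
        (fun p q hpq => by
          rw [dist_comm, dist_eq_norm]
          exact hsep k p q hpq)
        ENNReal.toReal_nonneg hωL one_pos
    have hlim : Tendsto (fun k : ℕ => compressionModulus g (θ * k)) atTop (𝓝 ∞) :=
      hρ.comp (tendsto_natCast_atTop_atTop.const_mul_atTop hθ)
    exact ENNReal.ofReal_ne_top (top_le_iff.1 (le_of_tendsto' hlim hle))
  · -- the averages `k⁻¹ ∑ x (p i)` have Hamming steps at most `2 / k` and separation `θ`
    obtain ⟨η, hη, hηρ⟩ : ∃ η : ℝ, 0 < η ∧ ENNReal.ofReal (5 * η) < compressionModulus g θ := by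
      obtain ⟨c, hc0, hc⟩ := ENNReal.lt_iff_exists_nnreal_btwn.1 (hρ θ hθ)
      refine ⟨c / 5, by simpa using hc0, ?_⟩
      rwa [mul_div_cancel₀ _ (by norm_num), ENNReal.ofReal_coe_nnreal]
    have hlim : Tendsto (fun k : ℕ => expansionModulus g (2 / k)) atTop (𝓝 0) := by
      refine hω.comp (tendsto_nhdsWithin_iff.2 ⟨tendsto_const_div_atTop_nhds_zero_nat 2, ?_⟩)
      filter_upwards [eventually_gt_atTop 0] with k hk
      have hk' : (0 : ℝ) < k := by exact_mod_cast hk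
      exact div_pos two_pos hk'
    obtain ⟨k, hkω, hk⟩ := ((hlim.eventually_lt_const (ENNReal.ofReal_pos.2 hη)).and
      (eventually_gt_atTop 0)).exists
    have hk' : (0 : ℝ) < k := by exact_mod_cast hk
    have hball : ∀ p : Fin k → ℕ, (k : ℝ)⁻¹ • ∑ i, x (p i) ∈ Metric.closedBall (0 : X) 1 := by
      intro p
      rw [mem_closedBall_zero_iff, norm_smul, norm_inv, Real.norm_natCast, inv_mul_le_one₀ hk']
      exact (norm_sum_le_of_le _ fun i _ => hx (p i)).trans (by simp)
    have hdist : ∀ p q : Fin k → ℕ, dist (⟨_, hball p⟩ : Metric.closedBall (0 : X) 1)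
        ⟨_, hball q⟩ = ‖∑ i, x (p i) - ∑ i, x (q i)‖ / k := by
      intro p q
      rw [Subtype.dist_eq, dist_eq_norm, ← smul_sub, norm_smul, norm_inv, Real.norm_natCast,
        inv_mul_eq_div]
    have hle : compressionModulus g θ ≤ ENNReal.ofReal (4 * η + η) :=
      exists_lt_compressionModulus_le g
        (fun p : Fin k → ℕ => (⟨_, hball p⟩ : Metric.closedBall (0 : X) 1))
        (fun p i m => by
          rw [hdist]
          exact div_le_div_of_nonneg_right (norm_sum_sub_sum_update_le hx p i m) hk'.le)
        (fun p q hpq => by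
          rw [hdist, le_div_iff₀ hk', norm_sub_rev]
          exact hsep k p q hpq)
        hη.le hkω.le hη
    rw [show 4 * η + η = 5 * η by ring] at hle
    exact hle.not_gt hηρ
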